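/- Let $k \ge 0$, let $\Xi \subset \mathbb{R}^k$ be a compact set with positive Lebesgue measure, let $f : \Xi \to \mathbb{R}$ be continuous, let $\mathbb{P}$ be a Borel probability measure on $\Xi$, and let $\varepsilon, \sigma, m > 0$. Write $\mathcal{P}(X)$ for the set of Borel probability measures on $X$ and $c(\xi,\zeta) = |\xi-\zeta|^2$ (Euclidean norm). For $\xi \in \Xi$ let $\nu_\xi \in \mathcal{P}(\Xi)$ be the law with density $$\zeta \mapsto \frac{e^{-|\xi-\zeta|^2/(2\sigma^2)}}{\int_\Xi e^{-|\xi-\eta|^2/(2\sigma^2)}\,d\eta}$$ with respect to the Lebesgue measure on $\Xi$, and let $\pi_0 \in \mathcal{P}(\Xi\times\Xi)$ be the reference coupling $\int \varphi\, d\pi_0 = \int_\Xi \int_\Xi \varphi(\xi,\zeta)\, d\nu_\xi(\zeta)\, d\mathbb{P}(\xi)$. For $\pi \in \mathcal{P}(\Xi\times\Xi)$ put $H(\pi) = \int \log\frac{d\pi}{d\pi_0}\, d\pi \in [0,+\infty]$ if $\pi$ is absolutely continuous with respect to $\pi_0$, and $H(\pi) = +\infty$ otherwise. For $\mathbb{Q}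 \in \mathcal{P}(\Xi)$ put $$W_\varepsilon(\mathbb{P},\mathbb{Q}) = \inf\Big\{ \int_{\Xi\times\Xi} c \, d\pi + \varepsilon H(\pi) \;:\; \pi \in \mathcal{P}(\Xi\times\Xi),\ \pi_1 = \mathbb{P},\ \pi_2 = \mathbb{Q}\Big\} \in [0,+\infty],$$ where $\pi_1,\pi_2$ are the marginals of $\pi$, and let $\mathcal{A}_W = \{\mathbb{Q} \in \mathcal{P}(\Xi) : W_\varepsilon(\mathbb{P},\mathbb{Q}) \le m\}$. Then, as an identity in $[-\infty,+\infty]$ (with $\sup\emptyset = -\infty$), $$\sup_{\mathbb{Q}\in\mathcal{A}_W} \int_\Xi f\, d\mathbb{Q} = \inf_{\lambda\ge 0} \left( \lambda m + \lambda\varepsilon \int_\Xi \log\left( \int_\Xi e^{\frac{f(\zeta)-\lambda c(\xi,\zeta)}{\lambda\varepsilon}}\, d\nu_\xi(\zeta)\right) d\mathbb{P}(\xi)\right),$$ where the expression on the right is read at $\lambda = 0$ as its limit for $\lambda \to 0^+$. -/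

import Mathlib

open MeasureTheory Topology
open scoped ENNReal

namespace EntropicDRO

noncomputable section

variable {k : ℕ} {Ξ : Set (EuclideanSpace ℝ (Fin k))}

/-- The Lebesgue measure of `Ξ`, as a measure on the space `Ξ`. -/
def lebesgue (Ξ : Set (EuclideanSpace ℝ (Fin k))) : Measure Ξ :=
  (volume : Measure (EuclideanSpace ℝ (Fin k))).comap Subtype.val

/-- The quadratic ground cost `c(ξ, ζ) = |ξ - ζ|²` on `Ξ`. -/
def cost (ξ ζ : Ξ) : ℝ :=
  ‖(ξ : EuclideanSpace ℝ (Fin k)) - (ζ : EuclideanSpace ℝ (Fin k))‖ ^ 2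

theorem continuous_cost : Continuous (fun z : Ξ × Ξ => cost z.1 z.2) := by
  unfold cost
  fun_prop

/-- The Gaussian law with centre `ξ` and variance `σ²`, restricted to `Ξ` and normalized:
its density with respect to the Lebesgue measure of `Ξ` is
`exp (-|ξ - ζ|² / (2σ²)) / ∫_Ξ exp (-|ξ - η|² / (2σ²)) dη`. -/
def nu (σ : ℝ) (ξ : Ξ) : Measure Ξ :=
  (lebesgue Ξ).tilted (fun ζ => -cost ξ ζ / (2 * σ ^ 2))

theorem sigmaFinite_lebesgue : SigmaFinite (lebesgue Ξ) := by
  let S := spanningSets (volume : Measure (EuclideanSpace ℝ (Fin k)))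
  refine ⟨⟨⟨fun n => Subtype.val ⁻¹' S n, fun _ => trivial, fun n => ?_, ?_⟩⟩⟩
  · have hn : MeasurableSet ((Subtype.val : Ξ → _) ⁻¹' S n) :=
      measurable_subtype_coe (measurableSet_spanningSets _ n)
    calc (lebesgue Ξ) (Subtype.val ⁻¹' S n)
        ≤ volume (Subtype.val '' ((Subtype.val : Ξ → _) ⁻¹' S n)) :=
          Measure.comap_apply_le _ _ hn.nullMeasurableSet
      _ ≤ volume (S n) := measure_mono (Set.image_preimage_subset _ _)
      _ < ∞ := measure_spanningSets_lt_top _ n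
  · rw [← Set.preimage_iUnion, iUnion_spanningSets, Set.preimage_univ]

/-- The law `nu σ ξ` depends measurably on the centre `ξ`. -/
theorem measurable_nu (σ : ℝ) : Measurable (nu σ : Ξ → Measure Ξ) := by
  have := sigmaFinite_lebesgue (Ξ := Ξ)
  have hd : Measurable (fun z : Ξ × Ξ => Real.exp (-cost z.1 z.2 / (2 * σ ^ 2))) := by
    have := (continuous_cost (Ξ := Ξ)).measurable
    fun_prop
  have hZ : Measurable (fun ξ : Ξ => ∫ ζ, Real.exp (-cost ξ ζ / (2 * σ ^ 2)) ∂(lebesgue Ξ)) :=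
    (hd.stronglyMeasurable.integral_prod_right' (ν := (lebesgue Ξ))).measurable
  have hq : Measurable (fun z : Ξ × Ξ => ENNReal.ofReal
      (Real.exp (-cost z.1 z.2 / (2 * σ ^ 2)) /
        ∫ ζ, Real.exp (-cost z.1 ζ / (2 * σ ^ 2)) ∂(lebesgue Ξ))) :=
    (hd.div (hZ.comp measurable_fst)).ennreal_ofReal
  refine Measure.measurable_of_measurable_coe _ fun s hs => ?_
  simp only [nu, tilted_apply' _ _ hs]
  exact hq.lintegral_prod_right' (ν := (lebesgue Ξ).restrict s)

/-- The map `ξ ↦ nu σ ξ` as a transition kernel. -/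
def nuKernel (σ : ℝ) : ProbabilityTheory.Kernel Ξ Ξ where
  toFun := nu σ
  measurable' := measurable_nu σ

/-- The reference coupling `π₀ = P ⊗ ν_ξ`, that is
`∫ φ dπ₀ = ∫ (∫ φ(ξ, ζ) dν_ξ(ζ)) dP(ξ)`. -/
def refCoupling (σ : ℝ) (P : Measure Ξ) : Measure (Ξ × Ξ) :=
  P.compProd (nuKernel σ)

/-- The entropy of a coupling `π` relative to the reference coupling `π₀`: the integral of
`log (dπ/dπ₀)` against `π` if `π ≪ π₀`, and `+∞` otherwise. For the probability measures
considered here this is the Kullback-Leibler divergence, with values in `[0, ∞]`. -/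
def entropy (σ : ℝ) (P : Measure Ξ) (π : Measure (Ξ × Ξ)) : ℝ≥0∞ :=
  InformationTheory.klDiv π (refCoupling σ P)

/-- Couplings of `P` and `Q`: measures on `Ξ × Ξ` with first marginal `P` and second
marginal `Q`. -/
def couplings (P Q : Measure Ξ) : Set (Measure (Ξ × Ξ)) :=
  {π | IsProbabilityMeasure π ∧ π.fst = P ∧ π.snd = Q}

/-- The entropy-regularized Wasserstein cost `W_ε(P, Q)`, with values in `[0, ∞]`. -/
def regWass (ε σ : ℝ) (P Q : Measure Ξ) : ℝ≥0∞ :=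
  ⨅ π ∈ couplings P Q,
    (∫⁻ z, ENNReal.ofReal (cost z.1 z.2) ∂π) + ENNReal.ofReal ε * entropy σ P π

/-- The ambiguity set `{Q : W_ε(P, Q) ≤ m}`. -/
def ambiguitySet (ε σ m : ℝ) (P : Measure Ξ) : Set (ProbabilityMeasure Ξ) :=
  {Q | regWass ε σ P (Q : Measure Ξ) ≤ ENNReal.ofReal m}

/-- The dual objective at a multiplier `l > 0`. -/
def dualPos (ε σ m : ℝ) (P : Measure Ξ) (f : Ξ → ℝ) (l : ℝ) : ℝ :=
  l * m + l * ε * ∫ ξ, Real.log (∫ ζ, Real.exp ((f ζ - l * cost ξ ζ) / (l * ε)) ∂(nu σ ξ)) ∂P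

open Classical in
/-- The dual objective at a multiplier `l ≥ 0`. The formula divides by `l`; its value at
`l = 0` is the limit as `l → 0⁺`. -/
def dualObjective (ε σ m : ℝ) (P : Measure Ξ) (f : Ξ → ℝ) (l : ℝ) : EReal :=
  if l = 0 then Filter.limsup (fun t : ℝ => (dualPos ε σ m P f t : EReal)) (𝓝[>] 0)
  else (dualPos ε σ m P f l : EReal)

end

end EntropicDRO

/-! Put `s = 1 / λ` and tilt the reference coupling by the potential `φ_s = (s f - c) / ε`,
normalizing on each fibre so that the first marginal stays `P`. Call the resulting Gibbs coupling
`π_s`. Let `A s` be the mean of `f` under `π_s`, `L s` the `P`-average of the log-partition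
function, and `R s` the value at `π_s` of transport cost plus `ε` times entropy. The conditional
Donsker-Varadhan inequality (`integral_le_klDiv_add_logPartition`) gives weak duality. Its equality
case at `π_s` (`klDiv_gibbs_ne_top`) gives `R s = s * A s - ε * L s`, so the dual value is `(m + ε *
L s) / s = A s + (m - R s) / s`. Strong duality thus reduces to choosing `s`. The gap vanishes if `R
s = m`. Otherwise continuity keeps `R - m` of one sign on `s > 0`, and `s` is taken large or close
to `0` (`exists_dual_le`). No minimax theorem or compactness of the ambiguity set is needed. -/

namespace EntropicDRO

open ProbabilityTheory

/-! ### Gibbs couplings and the conditional Gibbs variational principle. -/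

section Gibbs

variable {X : Type*} [MeasurableSpace X]

/-- The logarithm of the partition function of the potential `φ (x, ·)` under `κ x`. -/
noncomputable def logPartition (κ : Kernel X X) (φ : X × X → ℝ) (x : X) : ℝ :=
  Real.log (∫ y, Real.exp (φ (x, y)) ∂(κ x))

/-- The log-density of the conditional Gibbs law of the potential `φ`. -/
noncomputable def gibbsLog (κ : Kernel X X) (φ : X × X → ℝ) (z : X × X) : ℝ :=
  φ z - logPartition κ φ z.1

/-- The Gibbs coupling: first marginal `P`, conditional law proportional to `exp φ` under `κ`. -/
noncomputable def gibbs (P : Measure X) (κ : Kernel X X) (φ : X × X → ℝ) : Measure (X × X) :=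
  (P.compProd κ).tilted (gibbsLog κ φ)

theorem integrable_of_measurable_of_abs_le {Y : Type*} [MeasurableSpace Y] {μ : Measure Y}
    [IsFiniteMeasure μ] {g : Y → ℝ} {B : ℝ} (hg : Measurable g) (hB : ∀ y, |g y| ≤ B) :
    Integrable g μ :=
  Integrable.of_bound hg.aestronglyMeasurable B (.of_forall hB)

theorem integrable_exp_of_abs_le {Y : Type*} [MeasurableSpace Y] {μ : Measure Y}
    [IsFiniteMeasure μ] {g : Y → ℝ} {B : ℝ} (hg : Measurable g) (hB : ∀ y, |g y| ≤ B) :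
    Integrable (fun y => Real.exp (g y)) μ := by
  refine integrable_of_measurable_of_abs_le (B := Real.exp B) (by fun_prop) fun y => ?_
  rw [Real.abs_exp]
  exact Real.exp_le_exp.2 (le_of_abs_le (hB y))

variable {κ : Kernel X X} [IsMarkovKernel κ] {φ : X × X → ℝ} {B : ℝ}

theorem exp_neg_le_partition (hφ : Measurable φ) (hB : ∀ z, |φ z| ≤ B) (x : X) :
    Real.exp (-B) ≤ ∫ y, Real.exp (φ (x, y)) ∂(κ x) := by
  have h := integral_mono (μ := κ x) (integrable_const (Real.exp (-B)))
    (integrable_exp_of_abs_le (hφ.comp measurable_prodMk_left) fun y => hB (x, y))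
    fun y => Real.exp_le_exp.2 (neg_le_of_abs_le (hB (x, y)))
  simpa using h

theorem partition_le_exp (hφ : Measurable φ) (hB : ∀ z, |φ z| ≤ B) (x : X) :
    ∫ y, Real.exp (φ (x, y)) ∂(κ x) ≤ Real.exp B := by
  have h := integral_mono (μ := κ x)
    (integrable_exp_of_abs_le (hφ.comp measurable_prodMk_left) fun y => hB (x, y))
    (integrable_const (Real.exp B)) fun y => Real.exp_le_exp.2 (le_of_abs_le (hB (x, y)))
  simpa using h

theorem abs_logPartition_le (hφ : Measurable φ) (hB : ∀ z, |φ z| ≤ B) (x : X) :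
    |logPartition κ φ x| ≤ B := by
  have h1 := exp_neg_le_partition (κ := κ) hφ hB x
  have h2 := partition_le_exp (κ := κ) hφ hB x
  have h0 := (Real.exp_pos _).trans_le h1
  exact abs_le.2 ⟨(Real.le_log_iff_exp_le h0).2 h1, (Real.log_le_iff_le_exp h0).2 h2⟩

theorem measurable_logPartition (hφ : Measurable φ) :
    Measurable (logPartition κ φ) := by
  have : StronglyMeasurable fun x => ∫ y, Real.exp (φ (x, y)) ∂(κ x) :=
    (hφ.exp.stronglyMeasurable).integral_kernel_prod_right'
  exact this.measurable.log

theorem measurable_gibbsLog (hφ : Measurable φ) : Measurable (gibbsLog κ φ) :=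
  hφ.sub ((measurable_logPartition hφ).comp measurable_fst)

theorem abs_gibbsLog_le (hφ : Measurable φ) (hB : ∀ z, |φ z| ≤ B) (z : X × X) :
    |gibbsLog κ φ z| ≤ 2 * B := by
  have := abs_sub (φ z) (logPartition κ φ z.1)
  have := abs_logPartition_le (κ := κ) hφ hB z.1
  have := hB z
  unfold gibbsLog
  linarith

theorem integral_exp_gibbsLog_kernel (hφ : Measurable φ) (hB : ∀ z, |φ z| ≤ B) (x : X) :
    ∫ y, Real.exp (gibbsLog κ φ (x, y)) ∂(κ x) = 1 := by
  have h0 := (Real.exp_pos _).trans_le (exp_neg_le_partition (κ := κ) hφ hB x)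
  simp only [gibbsLog, Real.exp_sub, integral_div]
  rw [logPartition, Real.exp_log h0, div_self h0.ne']

theorem integral_gibbsLog_of_fst (hφ : Measurable φ) (hB : ∀ z, |φ z| ≤ B)
    {P : Measure X} {π : Measure (X × X)} [IsProbabilityMeasure π] (hπ : π.fst = P) :
    ∫ z, gibbsLog κ φ z ∂π = ∫ z, φ z ∂π - ∫ x, logPartition κ φ x ∂P := by
  have hm := measurable_logPartition (κ := κ) hφ
  unfold gibbsLog
  have hi : Integrable (fun z : X × X => logPartition κ φ z.1) π :=
    integrable_of_measurable_of_abs_le (hm.comp measurable_fst)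
      fun z => abs_logPartition_le hφ hB z.1
  rw [integral_sub (integrable_of_measurable_of_abs_le hφ hB) hi, ← hπ, Measure.fst,
    integral_map measurable_fst.aemeasurable hm.aestronglyMeasurable]

variable {P : Measure X} [IsProbabilityMeasure P]

theorem integrable_exp_gibbsLog (hφ : Measurable φ) (hB : ∀ z, |φ z| ≤ B) :
    Integrable (fun z => Real.exp (gibbsLog κ φ z)) (P.compProd κ) :=
  integrable_exp_of_abs_le (measurable_gibbsLog hφ) (abs_gibbsLog_le hφ hB)

theorem integral_exp_gibbsLog (hφ : Measurable φ) (hB : ∀ z, |φ z| ≤ B) :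
    ∫ z, Real.exp (gibbsLog κ φ z) ∂(P.compProd κ) = 1 := by
  rw [Measure.integral_compProd (integrable_exp_gibbsLog hφ hB)]
  simp [integral_exp_gibbsLog_kernel hφ hB]

theorem isProbabilityMeasure_gibbs (hφ : Measurable φ) (hB : ∀ z, |φ z| ≤ B) :
    IsProbabilityMeasure (gibbs P κ φ) :=
  isProbabilityMeasure_tilted (integrable_exp_gibbsLog hφ hB)

theorem integral_gibbs (hφ : Measurable φ) (hB : ∀ z, |φ z| ≤ B) (g : X × X → ℝ) :
    ∫ z, g z ∂(gibbs P κ φ) = ∫ z, Real.exp (gibbsLog κ φ z) * g z ∂(P.compProd κ) := by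
  rw [gibbs, integral_tilted, integral_exp_gibbsLog hφ hB]
  simp

/-- The density has integral one on every fibre, not merely globally, so tilting leaves the first
marginal unchanged. -/
theorem gibbs_fst (hφ : Measurable φ) (hB : ∀ z, |φ z| ≤ B) : (gibbs P κ φ).fst = P := by
  have hm := measurable_gibbsLog (κ := κ) hφ
  refine Measure.ext_of_lintegral _ fun g hg => ?_
  rw [Measure.fst, lintegral_map hg measurable_fst, gibbs, lintegral_tilted,
    integral_exp_gibbsLog hφ hB]
  simp only [div_one]
  rw [Measure.lintegral_compProd (by fun_prop)]
  refine lintegral_congr fun x => ?_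
  have hi : Integrable (fun y => Real.exp (gibbsLog κ φ (x, y))) (κ x) :=
    integrable_exp_of_abs_le (hm.comp measurable_prodMk_left)
      fun y => abs_gibbsLog_le hφ hB (x, y)
  dsimp only
  rw [lintegral_mul_const _ (by fun_prop), ← ofReal_integral_eq_lintegral_ofReal hi (.of_forall fun _ => (Real.exp_pos _).le),
    integral_exp_gibbsLog_kernel hφ hB]
  simp

/-- The equality case of the variational principle: the log-likelihood ratio is `gibbsLog` itself,
which is bounded. -/
theorem klDiv_gibbs_ne_top (hφ : Measurable φ) (hB : ∀ z, |φ z| ≤ B) :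
    InformationTheory.klDiv (gibbs P κ φ) (P.compProd κ) ≠ ∞ ∧
    (InformationTheory.klDiv (gibbs P κ φ) (P.compProd κ)).toReal =
      ∫ z, φ z ∂(gibbs P κ φ) - ∫ x, logPartition κ φ x ∂P := by
  have := isProbabilityMeasure_gibbs (P := P) (κ := κ) hφ hB
  have hm := measurable_gibbsLog (κ := κ) hφ
  have hac : gibbs P κ φ ≪ P.compProd κ := tilted_absolutelyContinuous _ _
  have hllr : llr (gibbs P κ φ) (P.compProd κ) =ᵐ[gibbs P κ φ] gibbsLog κ φ := by
    refine hac.ae_le ?_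
    have h := log_rnDeriv_tilted_left_self (integrable_exp_gibbsLog (P := P) (κ := κ) hφ hB)
    filter_upwards [h] with z hz
    rw [llr, gibbs, hz, integral_exp_gibbsLog hφ hB, Real.log_one, sub_zero]
  refine ⟨InformationTheory.klDiv_ne_top hac ?_, ?_⟩
  · exact (integrable_congr hllr).2
      (integrable_of_measurable_of_abs_le hm (abs_gibbsLog_le hφ hB))
  · rw [InformationTheory.toReal_klDiv_of_measure_eq hac (by simp), integral_congr_ae hllr,
      integral_gibbsLog_of_fst hφ hB (gibbs_fst hφ hB)]

/-- A conditional form of the Donsker-Varadhan inequality. -/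
theorem integral_le_klDiv_add_logPartition (hφ : Measurable φ) (hB : ∀ z, |φ z| ≤ B)
    {π : Measure (X × X)} [IsProbabilityMeasure π] (hπ : π.fst = P)
    (hkl : InformationTheory.klDiv π (P.compProd κ) ≠ ∞) :
    ∫ z, φ z ∂π ≤ (InformationTheory.klDiv π (P.compProd κ)).toReal +
      ∫ x, logPartition κ φ x ∂P := by
  have := isProbabilityMeasure_gibbs (P := P) (κ := κ) hφ hB
  have hm := measurable_gibbsLog (κ := κ) hφ
  have hexp := integrable_exp_gibbsLog (P := P) (κ := κ) hφ hB
  obtain ⟨hac, hint⟩ := InformationTheory.klDiv_ne_top_iff.1 hkl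
  -- The slack in the inequality is the divergence of `π` from the Gibbs coupling, which is
  -- nonnegative.
  have h0 : 0 ≤ ∫ z, llr π (gibbs P κ φ) z ∂π := by
    rw [← InformationTheory.toReal_klDiv_of_measure_eq
      (ν := gibbs P κ φ) (hac.trans (absolutelyContinuous_tilted hexp)) (by simp)]
    exact ENNReal.toReal_nonneg
  rw [gibbs, integral_llr_tilted_right hac
    (integrable_of_measurable_of_abs_le hm (abs_gibbsLog_le hφ hB)) hexp hint,
    integral_exp_gibbsLog hφ hB, integral_gibbsLog_of_fst hφ hB hπ] at h0
  rw [InformationTheory.toReal_klDiv_of_measure_eq hac (by simp)]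
  simp only [Real.log_one] at h0
  linarith

end Gibbs

/-! ### Continuous dependence on the inverse multiplier, by dominated convergence. -/

section Continuity

variable {X : Type*} [MeasurableSpace X] {κ : Kernel X X} [IsMarkovKernel κ]
  {P : Measure X} [IsProbabilityMeasure P] {φ : ℝ → X × X → ℝ} {B : ℝ → ℝ}

theorem continuous_logPartition (hφ : ∀ s, Measurable (φ s)) (hc : ∀ z, Continuous fun s => φ s z)
    (hB : ∀ r s, |s| ≤ r → ∀ z, |φ s z| ≤ B r) (x : X) :
    Continuous fun s => logPartition κ (φ s) x := by
  have hpos : ∀ s, 0 < ∫ y, Real.exp (φ s (x, y)) ∂(κ x) := fun s =>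
    (Real.exp_pos _).trans_le (exp_neg_le_partition (hφ s) (hB |s| s le_rfl) x)
  refine Continuous.log ?_ fun s => (hpos s).ne'
  refine continuous_iff_continuousAt.2 fun s₀ => ?_
  have hev : ∀ᶠ s in 𝓝 s₀, |s| ≤ |s₀| + 1 :=
    (continuous_abs.tendsto s₀).eventually_le_const (by linarith)
  refine continuousAt_of_dominated (bound := fun _ => Real.exp (B (|s₀| + 1)))
    (.of_forall fun s => ?_) (hev.mono fun s hs => .of_forall fun y => ?_) (integrable_const _)
    (.of_forall fun y => (hc (x, y)).rexp.continuousAt)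
  · exact ((hφ s).comp measurable_prodMk_left).exp.aestronglyMeasurable
  · rw [Real.norm_eq_abs, Real.abs_exp]
    exact Real.exp_le_exp.2 (le_of_abs_le (hB _ s hs _))

theorem continuous_integral_logPartition (hφ : ∀ s, Measurable (φ s))
    (hc : ∀ z, Continuous fun s => φ s z) (hB : ∀ r s, |s| ≤ r → ∀ z, |φ s z| ≤ B r) :
    Continuous fun s => ∫ x, logPartition κ (φ s) x ∂P := by
  refine continuous_iff_continuousAt.2 fun s₀ => ?_
  have hev : ∀ᶠ s in 𝓝 s₀, |s| ≤ |s₀| + 1 :=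
    (continuous_abs.tendsto s₀).eventually_le_const (by linarith)
  exact continuousAt_of_dominated (bound := fun _ => B (|s₀| + 1))
    (.of_forall fun s => (measurable_logPartition (hφ s)).aestronglyMeasurable)
    (hev.mono fun s hs => .of_forall fun x => abs_logPartition_le (hφ s) (hB _ s hs) x)
    (integrable_const _)
    (.of_forall fun x => (continuous_logPartition hφ hc hB x).continuousAt)

theorem continuous_integral_gibbs (hφ : ∀ s, Measurable (φ s))
    (hc : ∀ z, Continuous fun s => φ s z) (hB : ∀ r s, |s| ≤ r → ∀ z, |φ s z| ≤ B r)
    {g : X × X → ℝ} (hg : Measurable g) {M : ℝ} (hM : ∀ z, |g z| ≤ M) :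
    Continuous fun s => ∫ z, g z ∂(gibbs P κ (φ s)) := by
  simp only [fun s => integral_gibbs (P := P) (κ := κ) (hφ s) (hB |s| s le_rfl) g]
  refine continuous_iff_continuousAt.2 fun s₀ => ?_
  have hev : ∀ᶠ s in 𝓝 s₀, |s| ≤ |s₀| + 1 :=
    (continuous_abs.tendsto s₀).eventually_le_const (by linarith)
  refine continuousAt_of_dominated (bound := fun _ => Real.exp (2 * B (|s₀| + 1)) * M)
    (.of_forall fun s => ?_) (hev.mono fun s hs => .of_forall fun z => ?_) (integrable_const _)
    (.of_forall fun z => ?_)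
  · exact ((measurable_gibbsLog (hφ s)).exp.mul hg).aestronglyMeasurable
  · rw [Real.norm_eq_abs, abs_mul, Real.abs_exp]
    exact mul_le_mul (Real.exp_le_exp.2 (le_of_abs_le (abs_gibbsLog_le (hφ s) (hB _ s hs) z)))
      (hM z) (abs_nonneg _) (Real.exp_pos _).le
  · exact (((hc z).sub (continuous_logPartition hφ hc hB z.1)).rexp.mul
      continuous_const).continuousAt

end Continuity

/-- The one-dimensional part of the duality, in the variable `s = 1 / λ`. -/
theorem exists_dual_le {A L : ℝ → ℝ} (hA : Continuous A) (hL : Continuous L) {ε m v w : ℝ}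
    (hR : ∀ s, 0 ≤ s * A s - ε * L s) (hvw : v < w)
    (h : ∀ s, 0 ≤ s → s * A s - ε * L s ≤ m → A s ≤ v) :
    ∃ s, 0 < s ∧ (m + ε * L s) / s ≤ w := by
  have hRc : Continuous fun s => s * A s - ε * L s := by fun_prop
  have key : ∀ s, 0 < s → (m + ε * L s) / s = A s + (m - (s * A s - ε * L s)) / s := by
    intro s hs
    field_simp
    ring
  by_cases hb : ∃ s, 0 < s ∧ s * A s - ε * L s ≤ m
  · obtain ⟨s₁, hs₁, hm₁⟩ := hb
    by_cases hex : ∃ s, 0 < s ∧ s * A s - ε * L s = m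
    · obtain ⟨s, hs, hsm⟩ := hex
      refine ⟨s, hs, ?_⟩
      rw [key s hs, hsm]
      have := h s hs.le hsm.le
      simp only [sub_self, zero_div, add_zero]
      linarith
    · have hlt : ∀ s, 0 < s → s * A s - ε * L s ≤ m := by
        intro s hs
        by_contra hcon
        push Not at hcon
        obtain ⟨t, ht, htm⟩ := isPreconnected_Ioi.intermediate_value (s := Set.Ioi (0 : ℝ))
          (Set.mem_Ioi.2 hs₁) (Set.mem_Ioi.2 hs) hRc.continuousOn ⟨hm₁, hcon.le⟩
        exact hex ⟨t, ht, htm⟩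
      have hm0 : 0 ≤ m := (hR s₁).trans hm₁
      have hwv : 0 < w - v := sub_pos.2 hvw
      -- Since `R ≥ 0`, the gap is at most `m / s`; this `s` makes it at most `w - v`.
      refine ⟨m / (w - v) + 1, by positivity, ?_⟩
      have hs : 0 < m / (w - v) + 1 := by positivity
      rw [key _ hs]
      have h1 := h _ hs.le (hlt _ hs)
      have h2 : (m - ((m / (w - v) + 1) * A (m / (w - v) + 1) - ε * L (m / (w - v) + 1))) /
          (m / (w - v) + 1) ≤ w - v := by
        rw [div_le_iff₀ hs]
        have h3 := hR (m / (w - v) + 1)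
        have h4 : (w - v) * (m / (w - v) + 1) = m + (w - v) := by field_simp
        linarith
      linarith
  · push Not at hb
    have hpos : ∀ᶠ s : ℝ in 𝓝[>] 0, 0 < s := self_mem_nhdsWithin
    -- Here `R > m` on all of `s > 0`, and the inequality passes to the limit at `0`.
    have h0 : m ≤ 0 * A 0 - ε * L 0 := by
      have ht : Filter.Tendsto (fun s => s * A s - ε * L s) (𝓝[>] 0) (𝓝 (0 * A 0 - ε * L 0)) :=
        (hRc.tendsto 0).mono_left nhdsWithin_le_nhds
      refine ge_of_tendsto ht ?_
      filter_upwards [hpos] with s hs using (hb s hs).le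
    rcases h0.eq_or_lt with h0 | h0
    -- The coupling at `s = 0` is still feasible, so `A 0 ≤ v`, and by continuity `A s < w` for
    -- small `s`, where the gap term is nonpositive.
    · have hlt : A 0 < w := (h 0 le_rfl h0.ge).trans_lt hvw
      have hev : ∀ᶠ s in 𝓝[>] (0 : ℝ), A s < w :=
        ((hA.tendsto 0).mono_left nhdsWithin_le_nhds).eventually_lt_const hlt
      obtain ⟨s, hs, hsw⟩ := (hpos.and hev).exists
      refine ⟨s, hs, ?_⟩
      rw [key s hs]
      have := div_nonpos_of_nonpos_of_nonneg (sub_nonpos.2 (hb s hs).le) hs.le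
      linarith
    -- Now even the least possible regularized cost, `-ε * L 0`, exceeds `m`: this is the case of an
    -- empty ambiguity set, and the dual value tends to `-∞` as `s → 0⁺`.
    · have hneg : m + ε * L 0 < 0 := by linarith
      have hc : Continuous fun s => m + ε * L s := by fun_prop
      have ht := ((hc.tendsto 0).mono_left nhdsWithin_le_nhds).neg_mul_atTop hneg
        (tendsto_inv_nhdsGT_zero (𝕜 := ℝ))
      obtain ⟨s, hs, hsw⟩ := (hpos.and (ht.eventually_le_atBot w)).exists
      exact ⟨s, hs, by rwa [div_eq_mul_inv]⟩

/-! ### The Gaussian reference coupling on a compact set, and the two halves of the duality. -/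

section Compact

variable {k : ℕ} {Ξ : Set (EuclideanSpace ℝ (Fin k))}

theorem isFiniteMeasure_lebesgue (hΞ : IsCompact Ξ) : IsFiniteMeasure (lebesgue Ξ) := by
  refine ⟨?_⟩
  rw [lebesgue, comap_subtype_coe_apply hΞ.measurableSet, Set.image_univ, Subtype.range_coe]
  exact hΞ.measure_lt_top

theorem isMarkovKernel_nuKernel (hΞ : IsCompact Ξ) (hvol : 0 < volume Ξ) (σ : ℝ) :
    IsMarkovKernel (nuKernel σ : Kernel Ξ Ξ) := by
  have := isFiniteMeasure_lebesgue hΞ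
  have := isCompact_iff_compactSpace.1 hΞ
  -- Positive volume is essential: a tilt of the zero measure is zero, not a probability measure.
  have hne : NeZero (lebesgue Ξ) := by
    refine ⟨fun h => hvol.ne' ?_⟩
    have h' := congrArg (fun μ => μ Set.univ) h
    simpa [lebesgue, comap_subtype_coe_apply hΞ.measurableSet] using h'
  refine ⟨fun ξ => isProbabilityMeasure_tilted ?_⟩
  have hc : Continuous fun ζ : Ξ => Real.exp (-cost ξ ζ / (2 * σ ^ 2)) := by
    unfold cost
    fun_prop
  exact hc.integrable_of_hasCompactSupport (HasCompactSupport.of_compactSpace _)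

/-- The potential `(s f(ζ) - c(ξ, ζ)) / ε`, where `s` is the inverse of the multiplier. -/
noncomputable def potential (ε : ℝ) (f : Ξ → ℝ) (s : ℝ) (z : Ξ × Ξ) : ℝ :=
  (s * f z.2 - cost z.1 z.2) / ε

theorem measurable_potential (ε : ℝ) {f : Ξ → ℝ} (hf : Continuous f) (s : ℝ) :
    Measurable (potential ε f s) := by
  have h := continuous_cost (Ξ := Ξ)
  have : Continuous (potential ε f s) := by
    unfold potential
    fun_prop
  exact this.measurable

theorem exists_abs_le_of_continuous {Y : Type*} [TopologicalSpace Y] [CompactSpace Y] {g : Y → ℝ}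
    (hg : Continuous g) : ∃ M, 0 ≤ M ∧ ∀ y, |g y| ≤ M := by
  obtain ⟨M, hM⟩ := isCompact_univ.exists_bound_of_continuousOn hg.continuousOn
  exact ⟨max M 0, le_max_right _ _, fun y => (hM y trivial).trans (le_max_left _ _)⟩

theorem exists_abs_potential_le (hΞ : IsCompact Ξ) {ε : ℝ} (hε : 0 < ε) {f : Ξ → ℝ}
    (hf : Continuous f) : ∃ B : ℝ → ℝ, ∀ r s, |s| ≤ r → ∀ z, |potential ε f s z| ≤ B r := by
  have := isCompact_iff_compactSpace.1 hΞ
  obtain ⟨M, hM0, hM⟩ := exists_abs_le_of_continuous hf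
  obtain ⟨N, -, hN⟩ := exists_abs_le_of_continuous (continuous_cost (Ξ := Ξ))
  refine ⟨fun r => (r * M + N) / ε, fun r s hs z => ?_⟩
  rw [potential, abs_div, abs_of_pos hε]
  refine div_le_div_of_nonneg_right ((abs_sub _ _).trans (add_le_add ?_ (hN z))) hε.le
  rw [abs_mul]
  exact mul_le_mul hs (hM _) (abs_nonneg _) ((abs_nonneg _).trans hs)

/-- In the variable `s = l⁻¹` the potential is affine and stays regular at `s = 0`, the limit of
infinite multipliers. -/
theorem dualPos_eq {ε σ m : ℝ} {P : Measure Ξ} {f : Ξ → ℝ} {l : ℝ} (hl : 0 < l) :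
    dualPos ε σ m P f l =
      l * (m + ε * ∫ ξ, logPartition (nuKernel σ) (potential ε f l⁻¹) ξ ∂P) := by
  have h : ∀ ξ ζ : Ξ, (f ζ - l * cost ξ ζ) / (l * ε) = potential ε f l⁻¹ (ξ, ζ) := by
    intro ξ ζ
    rw [potential, mul_comm l ε, ← div_div, div_right_comm]
    congr 1
    field_simp
  simp only [dualPos, h]
  rw [mul_add, mul_assoc]
  rfl

theorem lintegral_cost (hΞ : IsCompact Ξ) (π : Measure (Ξ × Ξ)) [IsFiniteMeasure π] :
    ∫⁻ z, ENNReal.ofReal (cost z.1 z.2) ∂π = ENNReal.ofReal (∫ z, cost z.1 z.2 ∂π) := by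
  have := isCompact_iff_compactSpace.1 hΞ
  exact (ofReal_integral_eq_lintegral_ofReal (continuous_cost.integrable_of_hasCompactSupport
    (HasCompactSupport.of_compactSpace _)) (.of_forall fun z => by unfold cost; positivity)).symm

theorem integral_potential (hΞ : IsCompact Ξ) {ε : ℝ} {f : Ξ → ℝ} (hf : Continuous f) (s : ℝ)
    (π : Measure (Ξ × Ξ)) [IsFiniteMeasure π] :
    ∫ z, potential ε f s z ∂π = (s * ∫ z, f z.2 ∂π - ∫ z, cost z.1 z.2 ∂π) / ε := by
  have := isCompact_iff_compactSpace.1 hΞ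
  unfold potential
  have h1 : Integrable (fun z : Ξ × Ξ => s * f z.2) π :=
    Continuous.integrable_of_hasCompactSupport (by fun_prop) (HasCompactSupport.of_compactSpace _)
  have h2 : Integrable (fun z : Ξ × Ξ => cost z.1 z.2) π :=
    continuous_cost.integrable_of_hasCompactSupport (HasCompactSupport.of_compactSpace _)
  rw [integral_div, integral_sub h1 h2, integral_const_mul]

theorem integral_snd_coupling {f : Ξ → ℝ} (hf : Continuous f) (π : Measure (Ξ × Ξ)) :
    ∫ ζ, f ζ ∂π.snd = ∫ z, f z.2 ∂π := by
  rw [Measure.snd, integral_map measurable_snd.aemeasurable hf.measurable.aestronglyMeasurable]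

/-- Weak duality: the dual objective bounds the primal one on the ambiguity set. -/
theorem integral_le_dualPos (hΞ : IsCompact Ξ) (hvol : 0 < volume Ξ) {ε σ m : ℝ} (hε : 0 < ε)
    (hm : 0 < m) {P : Measure Ξ} [IsProbabilityMeasure P] {f : Ξ → ℝ} (hf : Continuous f)
    {Q : ProbabilityMeasure Ξ} (hQ : Q ∈ ambiguitySet ε σ m P) {l : ℝ} (hl : 0 < l) :
    ∫ ξ, f ξ ∂(Q : Measure Ξ) ≤ dualPos ε σ m P f l := by
  have := isMarkovKernel_nuKernel hΞ hvol σ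
  obtain ⟨B, hB⟩ := exists_abs_potential_le hΞ hε hf
  rw [dualPos_eq hl, ← div_le_iff₀' hl]
  -- The infimum defining `regWass` need not be known to be attained, so a coupling of cost below `m
  -- + δ` is used.
  refine le_of_forall_pos_le_add fun δ hδ => ?_
  have hlt : regWass ε σ P (Q : Measure Ξ) < ENNReal.ofReal (m + δ) :=
    lt_of_le_of_lt hQ ((ENNReal.ofReal_lt_ofReal_iff (by linarith)).2 (by linarith))
  simp only [regWass, iInf_lt_iff] at hlt
  obtain ⟨π, ⟨hπ, hπ1, hπ2⟩, hlt⟩ := hlt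
  have hkl : entropy σ P π ≠ ∞ := by
    intro h
    rw [h, ENNReal.mul_top (by simpa using hε)] at hlt
    simp at hlt
  have hDV := integral_le_klDiv_add_logPartition (κ := nuKernel σ)
    (measurable_potential ε hf l⁻¹) (hB |l⁻¹| l⁻¹ le_rfl) hπ1 hkl
  have hcost : 0 ≤ ∫ z, cost z.1 z.2 ∂π := integral_nonneg fun z => by unfold cost; positivity
  rw [lintegral_cost hΞ, ← ENNReal.ofReal_toReal hkl, ← ENNReal.ofReal_mul hε.le,
    ← ENNReal.ofReal_add hcost (by positivity),
    ENNReal.ofReal_lt_ofReal_iff (by linarith)] at hlt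
  rw [integral_potential hΞ hf, ← integral_snd_coupling hf, hπ2, div_le_iff₀ hε] at hDV
  change _ ≤ ((entropy σ P π).toReal + _) * ε at hDV
  rw [div_eq_inv_mul]
  linarith

/-- The expression `s * A s - ε * L s` is the regularized cost of the Gibbs coupling. It is
therefore nonnegative, and when it is at most `m` the second marginal is a competitor in the primal
problem. -/
theorem integral_gibbs_le_iSup (hΞ : IsCompact Ξ) (hvol : 0 < volume Ξ) {ε σ m : ℝ} (hε : 0 < ε)
    {P : Measure Ξ} [IsProbabilityMeasure P] {f : Ξ → ℝ} (hf : Continuous f) (s : ℝ) :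
    0 ≤ s * ∫ z, f z.2 ∂(gibbs P (nuKernel σ) (potential ε f s)) -
      ε * ∫ ξ, logPartition (nuKernel σ) (potential ε f s) ξ ∂P ∧
    (s * ∫ z, f z.2 ∂(gibbs P (nuKernel σ) (potential ε f s)) -
      ε * ∫ ξ, logPartition (nuKernel σ) (potential ε f s) ξ ∂P ≤ m →
    ((∫ z, f z.2 ∂(gibbs P (nuKernel σ) (potential ε f s)) : ℝ) : EReal) ≤
      ⨆ Q ∈ ambiguitySet ε σ m P, ((∫ ξ, f ξ ∂(Q : Measure Ξ) : ℝ) : EReal)) := by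
  have := isMarkovKernel_nuKernel hΞ hvol σ
  obtain ⟨B, hB⟩ := exists_abs_potential_le hΞ hε hf
  have hφ := measurable_potential ε hf s
  have hBs := hB |s| s le_rfl
  have hprob := isProbabilityMeasure_gibbs (P := P) (κ := nuKernel σ) hφ hBs
  obtain ⟨hkl, hklr⟩ := klDiv_gibbs_ne_top (P := P) (κ := nuKernel σ) hφ hBs
  have hfst := gibbs_fst (P := P) (κ := nuKernel σ) hφ hBs
  set π := gibbs P (nuKernel σ) (potential ε f s)
  rw [integral_potential hΞ hf] at hklr
  change entropy σ P π ≠ ∞ at hkl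
  change (entropy σ P π).toReal = _ at hklr
  have hcost : 0 ≤ ∫ z, cost z.1 z.2 ∂π := integral_nonneg fun z => by unfold cost; positivity
  have hR : s * ∫ z, f z.2 ∂π - ε * ∫ ξ, logPartition (nuKernel σ) (potential ε f s) ξ ∂P =
      ∫ z, cost z.1 z.2 ∂π + ε * (entropy σ P π).toReal := by
    rw [hklr]
    field_simp
    ring
  rw [hR]
  refine ⟨by positivity, fun hm => ?_⟩
  have hmem : (⟨π.snd, inferInstance⟩ : ProbabilityMeasure Ξ) ∈ ambiguitySet ε σ m P := by
    have hcoup : π ∈ couplings P π.snd := ⟨hprob, hfst, rfl⟩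
    have hle : regWass ε σ P π.snd ≤ (∫⁻ z, ENNReal.ofReal (cost z.1 z.2) ∂π) +
        ENNReal.ofReal ε * entropy σ P π := iInf₂_le π hcoup
    refine hle.trans ?_
    rw [lintegral_cost hΞ, ← ENNReal.ofReal_toReal hkl, ← ENNReal.ofReal_mul hε.le,
      ← ENNReal.ofReal_add hcost (by positivity)]
    exact ENNReal.ofReal_le_ofReal hm
  refine le_trans (le_of_eq ?_) (le_iSup₂ (f := fun (Q : ProbabilityMeasure Ξ)
    (_ : Q ∈ ambiguitySet ε σ m P) => ((∫ ξ, f ξ ∂(Q : Measure Ξ) : ℝ) : EReal)) _ hmem)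
  exact congrArg _ (integral_snd_coupling hf π).symm

/-- A lower bound valid at all positive multipliers survives the limsup at `l = 0`, so that endpoint
needs no separate analysis. -/
theorem le_dualObjective {ε σ m : ℝ} {P : Measure Ξ} {f : Ξ → ℝ} {U : EReal}
    (h : ∀ l, 0 < l → U ≤ dualPos ε σ m P f l) {l : ℝ} (hl : 0 ≤ l) :
    U ≤ dualObjective ε σ m P f l := by
  rcases hl.eq_or_lt with rfl | hl
  · rw [dualObjective, if_pos rfl]
    refine Filter.le_limsup_of_frequently_le' (Filter.Eventually.frequently ?_)
    filter_upwards [self_mem_nhdsWithin] with t ht using h t ht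
  · rw [dualObjective, if_neg hl.ne']
    exact h l hl

end Compact

end EntropicDRO

open EntropicDRO in
theorem proposition2p1 {k : ℕ} (Ξ : Set (EuclideanSpace ℝ (Fin k))) (hΞ : IsCompact Ξ)
    (hvol : 0 < volume Ξ) (ε σ m : ℝ) (hε : 0 < ε) (hσ : 0 < σ) (hm : 0 < m)
    (P : Measure Ξ) [IsProbabilityMeasure P] (f : Ξ → ℝ) (hf : Continuous f) :
    (⨆ Q ∈ EntropicDRO.ambiguitySet ε σ m P, ((∫ ξ, f ξ ∂(Q : Measure Ξ) : ℝ) : EReal)) =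
      ⨅ l ∈ Set.Ici (0 : ℝ), EntropicDRO.dualObjective ε σ m P f l := by
  apply le_antisymm
  · refine iSup₂_le fun Q hQ => le_iInf₂ fun l hl => le_dualObjective (fun t ht => ?_) hl
    exact EReal.coe_le_coe_iff.2 (integral_le_dualPos hΞ hvol hε hm hf hQ ht)
  · have := isMarkovKernel_nuKernel hΞ hvol σ
    have := isCompact_iff_compactSpace.1 hΞ
    obtain ⟨B, hB⟩ := exists_abs_potential_le hΞ hε hf
    obtain ⟨M, -, hM⟩ := exists_abs_le_of_continuous hf
    have hc : ∀ z, Continuous fun s => potential ε f s z := fun z => by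
      unfold potential
      fun_prop
    have hL := continuous_integral_logPartition (κ := nuKernel σ) (P := P)
      (measurable_potential ε hf) hc hB
    have hA := continuous_integral_gibbs (κ := nuKernel σ) (P := P)
      (measurable_potential ε hf) hc hB (hf.measurable.comp measurable_snd) fun z => hM z.2
    -- Testing against real `w` above the supremum also covers the value `-∞`; the intermediate real
    -- `v` leaves room for a dual value that is only approached.
    refine EReal.le_of_forall_lt_iff_le.1 fun w hw => ?_
    obtain ⟨v, hv, hvw⟩ := EReal.lt_iff_exists_real_btwn.1 hw
    obtain ⟨s, hs, hsw⟩ := exists_dual_le hA hL (ε := ε) (m := m)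
      (fun s => (integral_gibbs_le_iSup (m := m) hΞ hvol hε hf s).1) (EReal.coe_lt_coe_iff.1 hvw)
      fun s _ hR => EReal.coe_le_coe_iff.1
        (((integral_gibbs_le_iSup hΞ hvol hε hf s).2 hR).trans hv.le)
    refine (iInf₂_le s⁻¹ (Set.mem_Ici.2 (inv_pos.2 hs).le)).trans ?_
    rw [dualObjective, if_neg (inv_pos.2 hs).ne', EReal.coe_le_coe_iff,
      dualPos_eq (inv_pos.2 hs), inv_inv, ← div_eq_inv_mul]
    exact hsw
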